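/- Let $K$ be an algebraically closed field of characteristic $0$, and let $N<d$ be non-negative integers. For a finite set $Z$ of points of $\mathbf P^d$ let $I(Z)=\bigcap_{P\in Z}I(P)\subset K[x_0,\dots,x_d]$, where $I(P)$ is the ideal generated by the forms vanishing at $P$, and let $M=(x_0,\dots,x_d)$. For an ideal $I$ of $R=K[x_0,\dots,x_d]$, the $m$-th symbolic power is $I^{(m)}=\bigcap_{P\in\operatorname{Ass}(R/I)}(I^mR_P\cap R)$. A star configuration of points in $\mathbf P^N$ is the set of the $\binom sN$ points at which $N$ of the hyperplanes meet, for some $s\ge N$ hyperplanes in $\mathbf P^N$ any $N$ of which meet in exactly one point and no $N+1$ of which have a common point. Let $Z=P_1+\cdots+P_n$ be a star configuration of points in $\mathbf P^N$, where $\mathbf P^N$ is regarded as a linear subspace of the larger projective space $\mathbf P^d$, and let $I=I(Z_{\mathbf P^d})$ be the ideal of these points, taken with their reduced structure as points of $\mathbf P^d$. Then for all $r\ge 1$: (a) $I^{(rd)}\subseteq M^{r(d-1)}I^r$, and (b) $I^{(rd-(d-1))}\subseteq M^{(r-1)(d-1)}I^r$. -/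

import Mathlib

open scoped LinearAlgebra.Projectivization

/-- The `m`-th symbolic power of an ideal `I` of a (Noetherian) ring `R`: the intersection, over
the associated primes `P` of `R ⧸ I`, of the contractions `I ^ m R_P ∩ R`. Equivalently, the
intersection of those components of a primary decomposition of `I ^ m` whose radical lies in some
associated prime of `I`. -/
def symbolicPower {R : Type*} [CommRing R] (I : Ideal R) (m : ℕ) : Ideal R where
  carrier := {f | ∀ P ∈ associatedPrimes R (R ⧸ I), ∃ s : R, s ∉ P ∧ s * f ∈ I ^ m}
  zero_mem' := fun P hP => ⟨1, (Ideal.ne_top_iff_one P).1 hP.isPrime.ne_top, by simp⟩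
  add_mem' := by
    intro a b ha hb P hP
    obtain ⟨s, hs, hsa⟩ := ha P hP
    obtain ⟨t, ht, htb⟩ := hb P hP
    refine ⟨s * t, fun h => (hP.isPrime.mem_or_mem h).elim hs ht, ?_⟩
    have h : s * t * (a + b) = t * (s * a) + s * (t * b) := by ring
    rw [h]
    exact Ideal.add_mem _ (Ideal.mul_mem_left _ _ hsa) (Ideal.mul_mem_left _ _ htb)
  smul_mem' := by
    intro c a ha P hP
    obtain ⟨s, hs, hsa⟩ := ha P hP
    refine ⟨s, hs, ?_⟩
    rw [smul_eq_mul, mul_left_comm]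
    exact Ideal.mul_mem_left _ _ hsa

/-- Projective space `P^N` over `K`: the lines through the origin of `K^(N+1)`. -/
abbrev ProjSpace (K : Type*) [Field K] (N : ℕ) : Type _ :=
  ℙ K (Fin (N + 1) → K)

/-- The ideal `I(P)` generated by the forms in `K[x_0, …, x_N]` that vanish at the point `P`. -/
noncomputable def pointIdeal {K : Type*} [Field K] {N : ℕ} (P : ProjSpace K N) :
    Ideal (MvPolynomial (Fin (N + 1)) K) :=
  Ideal.span {f | (∃ k : ℕ, f.IsHomogeneous k) ∧ ∀ v ∈ P.submodule, MvPolynomial.eval v f = 0}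

/-- The radical ideal `I(Z) = ⋂_{P ∈ Z} I(P)` of a set `Z` of points of `P^N`. -/
noncomputable def pointsIdeal {K : Type*} [Field K] {N : ℕ} (Z : Set (ProjSpace K N)) :
    Ideal (MvPolynomial (Fin (N + 1)) K) :=
  ⨅ P ∈ Z, pointIdeal P

/-- The hyperplane of `P^N` where the linear form `L` vanishes. -/
def hyperplane {K : Type*} [Field K] {N : ℕ} (L : Module.Dual K (Fin (N + 1) → K)) :
    Set (ProjSpace K N) :=
  {P | P.submodule ≤ LinearMap.ker L}

/-- `Z` is a star configuration of points in `P^N`: for some `s ≥ N` there are `s` hyperplanes in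
`P^N` such that any `N` of them meet in exactly one point, no `N + 1` of them have a common point,
and `Z` consists of the points where `N` of the hyperplanes meet. -/
def IsStarConfiguration {K : Type*} [Field K] {N : ℕ} (Z : Set (ProjSpace K N)) : Prop :=
  ∃ (s : ℕ) (L : Fin s → Module.Dual K (Fin (N + 1) → K)),
    N ≤ s ∧ (∀ i, L i ≠ 0) ∧
    (∀ S : Finset (Fin s), S.card = N → ∃! P : ProjSpace K N, ∀ i ∈ S, P ∈ hyperplane (L i)) ∧
    (∀ S : Finset (Fin s), S.card = N + 1 → ¬ ∃ P : ProjSpace K N, ∀ i ∈ S, P ∈ hyperplane (L i)) ∧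
    Z = {P | ∃ S : Finset (Fin s), S.card = N ∧ ∀ i ∈ S, P ∈ hyperplane (L i)}

/-!
The points of the star configuration are cut out, inside `P^d`, by linear forms: `z (inl i)`
extends the `i`-th hyperplane of `P^N`, and `z (inr j)`, `j < d - N`, are equations of `P^N` in
`P^d`. For a set `B` of forms that consists of `N` of the first kind and all of the second, the
forms of `B` are independent, and the ideal `(z i : i ∈ B)` is the ideal of a point of `Z`; the
remaining forms do not vanish there.

Each of these ideals is an associated prime of `R ⧸ I`, and its powers are primary, so that the
symbolic power `I^(m)` lies in `⋂_B (z i : i ∈ B)^m` (`symbolicPower_le_formsIdeal_pow`). The heart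
of the proof is that this intersection is generated by monomials in the forms `z`, namely those
whose exponents add up to at least `m` over each `B` (`mem_monomialsIdeal_sup`). As the sets `B`
are the bases of a matroid, this can be shown by restricting to the hyperplane `z i = 0`, lifting a
combination of monomials from there and dividing the difference by `z i`. The exponents that
remain to be reached then depend on the set `B`, which is why weights `c` are carried along; if `i`
is chosen with `c i` minimal, then the exchange property shows that the lifted monomials satisfy
the conditions for the sets `B` that do not contain `i`, too.

Division by `z i` in these ideals rests on a substitution `θ : R → R[t]` that multiplies the forms
of `B` by `t`: membership in the `k`-th power of the ideal of a point means that `t ^ k` divides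
`θ f`, and `t` is prime (`CutsOutPoint.exists_rescale`).

What remains is a statement about monomials (`prod_mul_prod_mem`). The ideal `I` contains the
forms `z (inr j)` and the products of `s - N + 1` distinct forms `z (inl i)`. If a monomial has
degree `k` in the `z (inr j)`, then the `N`-th smallest exponent of the `z (inl i)` is at least
`r - k` as soon as `m ≥ (r - 1) d + 1`; hence `r` factors from `I` can be split off, and a factor
of degree at least `m - r` is left. Both inclusions are the resulting
`I^(m) ⊆ M^(m - r) I^r`, with `m = r d` and `m = (r - 1) d + 1`.
-/

/-! ### Linear forms as polynomials -/

theorem exists_dual_apply_eq_one {K V : Type*} [Field K] [AddCommGroup V] [Module K V] {v : V}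
    (hv : v ≠ 0) : ∃ L : Module.Dual K V, L v = 1 := by
  obtain ⟨L, hL⟩ : ∃ L : Module.Dual K V, L v ≠ 0 := by
    by_contra! hc
    exact hv ((Module.forall_dual_apply_eq_zero_iff K v).1 hc)
  exact ⟨(L v)⁻¹ • L, by simp [hL]⟩

section LinearForm

variable {K σ : Type*} [Field K] [Fintype σ] [DecidableEq σ]

/-- The linear polynomial on `K^σ` given by a functional `L`. -/
noncomputable def linearForm :
    Module.Dual K (σ → K) →ₗ[K] MvPolynomial σ K where
  toFun L := ∑ j, L (Pi.single j 1) • MvPolynomial.X j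
  map_add' L L' := by simp [add_smul, Finset.sum_add_distrib]
  map_smul' c L := by simp [mul_smul, Finset.smul_sum]

theorem linearForm_apply (L : Module.Dual K (σ → K)) :
    linearForm L = ∑ j, L (Pi.single j 1) • (MvPolynomial.X j : MvPolynomial σ K) := rfl

theorem dual_apply_eq_sum (L : Module.Dual K (σ → K)) (v : σ → K) :
    L v = ∑ j, v j * L (Pi.single j 1) := by
  conv_lhs => rw [LinearMap.pi_apply_eq_sum_univ L v]
  refine Finset.sum_congr rfl fun j _ => ?_
  rw [smul_eq_mul]
  congr 2
  ext i
  simp [Pi.single_apply, eq_comm]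

theorem eval_linearForm (L : Module.Dual K (σ → K)) (v : σ → K) :
    MvPolynomial.eval v (linearForm L) = L v := by
  rw [dual_apply_eq_sum, linearForm_apply]
  simp [MvPolynomial.smul_eval, mul_comm]

theorem linearForm_proj (j : σ) :
    linearForm (LinearMap.proj j : Module.Dual K (σ → K)) = MvPolynomial.X j := by
  rw [linearForm_apply, Finset.sum_eq_single j]
  · simp
  · intro i _ hij
    simp [Ne.symm hij]
  · simp

theorem dual_eq_sum_proj (L : Module.Dual K (σ → K)) :
    L = ∑ j, L (Pi.single j 1) • (LinearMap.proj j : Module.Dual K (σ → K)) := by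
  ext j
  simp [Pi.single_apply]

theorem linearForm_ne_zero {L : Module.Dual K (σ → K)} {v : σ → K} (h : L v ≠ 0) :
    linearForm L ≠ 0 := by
  intro h0
  rw [← eval_linearForm, h0, map_zero] at h
  exact h rfl

theorem isHomogeneous_linearForm (L : Module.Dual K (σ → K)) :
    (linearForm L).IsHomogeneous 1 := by
  rw [linearForm_apply]
  refine MvPolynomial.IsHomogeneous.sum _ _ _ fun j _ => ?_
  rw [MvPolynomial.smul_eq_C_mul]
  simpa using (MvPolynomial.isHomogeneous_C σ (L (Pi.single j 1))).mul
    (MvPolynomial.isHomogeneous_X K j)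

theorem linearForm_mem_span_X (L : Module.Dual K (σ → K)) :
    linearForm L ∈ Ideal.span (Set.range (MvPolynomial.X : σ → MvPolynomial σ K)) := by
  rw [linearForm_apply]
  refine Submodule.sum_mem _ fun j _ => ?_
  rw [MvPolynomial.smul_eq_C_mul]
  exact Ideal.mul_mem_left _ _ (Ideal.subset_span ⟨j, rfl⟩)

variable {κ : Type*}

/-- The ideal generated by the linear forms `z i`, `i ∈ T`. -/
noncomputable def formsIdeal (z : κ → Module.Dual K (σ → K)) (T : Finset κ) :
    Ideal (MvPolynomial σ K) :=
  Ideal.span ((fun i => linearForm (z i)) '' T)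

theorem linearForm_mem_formsIdeal (z : κ → Module.Dual K (σ → K)) {T : Finset κ} {i : κ}
    (hi : i ∈ T) : linearForm (z i) ∈ formsIdeal z T :=
  Ideal.subset_span ⟨i, hi, rfl⟩

theorem formsIdeal_mono (z : κ → Module.Dual K (σ → K)) {S T : Finset κ} (h : S ⊆ T) :
    formsIdeal z S ≤ formsIdeal z T :=
  Ideal.span_mono (Set.image_mono (by exact_mod_cast h))

@[simp]
theorem formsIdeal_empty (z : κ → Module.Dual K (σ → K)) : formsIdeal z ∅ = ⊥ := by
  simp [formsIdeal]

theorem formsIdeal_insert [DecidableEq κ] (z : κ → Module.Dual K (σ → K)) (T : Finset κ) (i : κ) :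
    formsIdeal z (insert i T) = Ideal.span {linearForm (z i)} ⊔ formsIdeal z T := by
  rw [formsIdeal, Finset.coe_insert, Set.image_insert_eq, Ideal.span_insert]
  rfl

theorem linearForm_mem_formsIdeal_of_mem_span {z : κ → Module.Dual K (σ → K)} {T : Finset κ}
    {L : Module.Dual K (σ → K)} (h : L ∈ Submodule.span K (z '' T)) :
    linearForm L ∈ formsIdeal z T := by
  induction h using Submodule.span_induction with
  | mem x hx =>
    obtain ⟨i, hi, rfl⟩ := hx
    exact linearForm_mem_formsIdeal z hi
  | zero => simp
  | add x y _ _ hx hy => rw [map_add]; exact add_mem hx hy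
  | smul c x _ hx =>
    rw [map_smul, MvPolynomial.smul_eq_C_mul]
    exact Ideal.mul_mem_left _ _ hx

end LinearForm

/-! ### Orders of vanishing along a flag of linear subspaces -/

section Order

variable {K σ κ : Type*} [Field K]

/-- The functionals `z i`, `i ∈ B`, are linearly independent and span the space of functionals
that vanish at `v ≠ 0`: they form a system of linear equations for the point `[v]`. -/
structure CutsOutPoint (z : κ → Module.Dual K (σ → K)) (B : Finset κ) (v : σ → K) : Prop where
  indep : LinearIndepOn K z (B : Set κ)
  mem_span_iff : ∀ L : Module.Dual K (σ → K), L ∈ Submodule.span K (z '' B) ↔ L v = 0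
  ne_zero : v ≠ 0

variable [Fintype σ] [DecidableEq σ] {z : κ → Module.Dual K (σ → K)} {B : Finset κ} {v : σ → K}

theorem CutsOutPoint.eval_eq_zero (h : CutsOutPoint z B v) {f : MvPolynomial σ K}
    (hf : f ∈ formsIdeal z B) : MvPolynomial.eval v f = 0 := by
  rw [← RingHom.mem_ker]
  refine (Ideal.span_le.2 ?_ : formsIdeal z B ≤ RingHom.ker (MvPolynomial.eval v)) hf
  rintro _ ⟨i, hi, rfl⟩
  rw [SetLike.mem_coe, RingHom.mem_ker, eval_linearForm]
  exact (h.mem_span_iff _).1 (Submodule.subset_span ⟨i, hi, rfl⟩)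

/-- A point with linear equations `z i`, `i ∈ B`, has `formsIdeal z B` as its homogeneous ideal. -/
theorem CutsOutPoint.span_homogeneous_eq (h : CutsOutPoint z B v) :
    Ideal.span {f : MvPolynomial σ K | (∃ k : ℕ, f.IsHomogeneous k) ∧
      ∀ u ∈ Submodule.span K {v}, MvPolynomial.eval u f = 0} = formsIdeal z B := by
  apply le_antisymm
  · rw [Ideal.span_le]
    rintro f ⟨⟨k, hk⟩, hf⟩
    obtain ⟨L₀, hL₀⟩ := exists_dual_apply_eq_one (K := K) h.ne_zero
    -- Modulo the forms that vanish at `v`, each variable `x_j` is `v_j · L₀`, so that `f` is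
    -- congruent to `f(v) · L₀ ^ k`.
    have hcongr : (Ideal.Quotient.mkₐ K (formsIdeal z B)) f =
        (Ideal.Quotient.mkₐ K (formsIdeal z B))
          (MvPolynomial.aeval (fun j => v j • linearForm L₀) f) := by
      have : Ideal.Quotient.mkₐ K (formsIdeal z B) = (Ideal.Quotient.mkₐ K (formsIdeal z B)).comp
          (MvPolynomial.aeval (fun j => v j • linearForm L₀)) := by
        refine MvPolynomial.algHom_ext fun j => ?_
        rw [AlgHom.comp_apply, MvPolynomial.aeval_X]
        change Ideal.Quotient.mk _ _ = Ideal.Quotient.mk _ _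
        rw [Ideal.Quotient.eq, ← map_smul, ← linearForm_proj, ← map_sub]
        refine linearForm_mem_formsIdeal_of_mem_span ((h.mem_span_iff _).2 ?_)
        simp [hL₀]
      exact congrArg (fun g => g f) this
    have hzero : MvPolynomial.aeval (fun j => v j • linearForm L₀) f = 0 := by
      have hv := hf v (Submodule.mem_span_singleton_self v)
      rw [MvPolynomial.eval_eq] at hv
      rw [MvPolynomial.aeval_def, MvPolynomial.eval₂_eq]
      have : ∀ d ∈ f.support, algebraMap K (MvPolynomial σ K) (f.coeff d) *
          ∏ i ∈ d.support, (v i • linearForm L₀) ^ d i =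
          MvPolynomial.C (f.coeff d * ∏ i ∈ d.support, v i ^ d i) * linearForm L₀ ^ k := by
        intro d hd
        have hdeg : ∑ i ∈ d.support, d i = k := by
          have := hk (MvPolynomial.mem_support_iff.1 hd)
          rw [← this, Finsupp.weight_apply, Finsupp.sum]
          simp
        simp only [MvPolynomial.smul_eq_C_mul, mul_pow, Finset.prod_mul_distrib,
          Finset.prod_pow_eq_pow_sum, hdeg, map_mul, map_prod, map_pow, MvPolynomial.algebraMap_eq]
        ring
      rw [Finset.sum_congr rfl this, ← Finset.sum_mul, ← map_sum, hv, map_zero, zero_mul]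
    rw [hzero, map_zero] at hcongr
    exact Ideal.Quotient.eq_zero_iff_mem.1 hcongr
  · rw [formsIdeal, Ideal.span_le]
    rintro _ ⟨i, hi, rfl⟩
    refine Ideal.subset_span ⟨⟨1, isHomogeneous_linearForm _⟩, fun u hu => ?_⟩
    obtain ⟨c, rfl⟩ := Submodule.mem_span_singleton.1 hu
    rw [eval_linearForm, map_smul, (h.mem_span_iff _).1 (Submodule.subset_span ⟨i, hi, rfl⟩),
      smul_zero]

/-- The substitution that sends a linear form `w` to `w(v) · L₀ + t · p(w)`. -/
noncomputable def rescale (v : σ → K) (L₀ : Module.Dual K (σ → K))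
    (p : Module.Dual K (σ → K) →ₗ[K] Module.Dual K (σ → K)) :
    MvPolynomial σ K →ₐ[K] Polynomial (MvPolynomial σ K) :=
  MvPolynomial.aeval fun j =>
    Polynomial.C (linearForm (v j • L₀)) +
      Polynomial.X * Polynomial.C (linearForm (p (LinearMap.proj j)))

theorem rescale_linearForm (v : σ → K) (L₀ : Module.Dual K (σ → K))
    (p : Module.Dual K (σ → K) →ₗ[K] Module.Dual K (σ → K)) (w : Module.Dual K (σ → K)) :
    rescale v L₀ p (linearForm w) =
      Polynomial.C (linearForm (w v • L₀)) + Polynomial.X * Polynomial.C (linearForm (p w)) := by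
  have hC : ∀ (a : K) (g : MvPolynomial σ K), Polynomial.C (a • g) = a • Polynomial.C g :=
    fun a g => by rw [Polynomial.smul_C]
  conv_rhs => rw [dual_apply_eq_sum w v, dual_eq_sum_proj w]
  rw [linearForm_apply, map_sum, Finset.sum_smul, map_sum, map_sum, map_sum, map_sum, map_sum,
    Finset.mul_sum, ← Finset.sum_add_distrib]
  refine Finset.sum_congr rfl fun j _ => ?_
  simp only [rescale, map_smul, MvPolynomial.aeval_X, hC, smul_add, mul_smul_comm]
  rw [smul_smul, mul_comm (w _)]
  congr 1
  simp [Pi.single_apply]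

/-- For `A ⊆ B` there is a substitution `θ : R → R[t]` that kills the forms of `A` and multiplies
those of `B \ A` by `t`; divisibility of `θ f` by `t ^ k` detects membership of `f` in
`(z i : i ∈ B \ A) ^ k + (z i : i ∈ A)`. -/
theorem CutsOutPoint.exists_rescale [DecidableEq κ]
    (h : CutsOutPoint z B v) {A : Finset κ} (hA : A ⊆ B) :
    ∃ θ : MvPolynomial σ K →ₐ[K] Polynomial (MvPolynomial σ K),
      (∀ k f, f ∈ formsIdeal z (B \ A) ^ k ⊔ formsIdeal z A ↔ Polynomial.X ^ k ∣ θ f) ∧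
      (∀ L : Module.Dual K (σ → K), L v ≠ 0 → ¬ Polynomial.X ∣ θ (linearForm L)) ∧
      (∀ i ∈ B \ A, θ (linearForm (z i)) = Polynomial.X * Polynomial.C (linearForm (z i))) := by
  obtain ⟨L₀, hL₀⟩ := exists_dual_apply_eq_one (K := K) h.ne_zero
  -- `p₁` is the projection of the span of `B` to that of `B \ A`, extended to all functionals.
  obtain ⟨p₁, hp₁⟩ : ∃ p₁ : Module.Dual K (σ → K) →ₗ[K] Module.Dual K (σ → K),
      ∀ i ∈ B, p₁ (z i) = if i ∈ A then 0 else z i := by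
    have hli : LinearIndependent K (fun i : (B : Set κ) => z i) := h.indep
    obtain ⟨g, hg⟩ := LinearMap.exists_extend
      ((Module.Basis.span hli).constr K (fun i : (B : Set κ) => if (i : κ) ∈ A then 0 else z i))
    refine ⟨g, fun i hi => ?_⟩
    have h1 := congrArg (fun f => f (Module.Basis.span hli ⟨i, hi⟩)) hg
    simp only [Module.Basis.constr_basis, LinearMap.comp_apply, Submodule.subtype_apply] at h1
    rw [Module.Basis.span_apply] at h1
    exact h1
  set q : Module.Dual K (σ → K) →ₗ[K] Module.Dual K (σ → K) :=
    LinearMap.id - (Module.Dual.eval K (σ → K) v).smulRight L₀ with hq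
  have hq_apply : ∀ w, q w = w - w v • L₀ := fun w => by simp [hq]
  have hq_mem : ∀ w, q w ∈ Submodule.span K (z '' B) := fun w => by
    rw [h.mem_span_iff, hq_apply]; simp [hL₀]
  have hz : ∀ i ∈ B, z i v = 0 := fun i hi =>
    (h.mem_span_iff _).1 (Submodule.subset_span ⟨i, hi, rfl⟩)
  have hqz : ∀ i ∈ B, q (z i) = z i := fun i hi => by rw [hq_apply, hz i hi]; simp
  have hp_mem : ∀ x ∈ Submodule.span K (z '' B),
      p₁ x ∈ Submodule.span K (z '' (B \ A : Finset κ)) := by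
    intro x hx
    induction hx using Submodule.span_induction with
    | mem x hx =>
      obtain ⟨i, hi, rfl⟩ := hx
      rw [hp₁ i hi]
      split_ifs with hiA
      · exact zero_mem _
      · exact Submodule.subset_span ⟨i, by simpa using ⟨hi, hiA⟩, rfl⟩
    | zero => simp
    | add x y _ _ hx hy => rw [map_add]; exact add_mem hx hy
    | smul c x _ hx => rw [map_smul]; exact Submodule.smul_mem _ _ hx
  have hp_sub : ∀ x ∈ Submodule.span K (z '' B), p₁ x - x ∈ Submodule.span K (z '' A) := by
    intro x hx
    induction hx using Submodule.span_induction with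
    | mem x hx =>
      obtain ⟨i, hi, rfl⟩ := hx
      rw [hp₁ i hi]
      split_ifs with hiA
      · rw [zero_sub]
        exact neg_mem (Submodule.subset_span ⟨i, hiA, rfl⟩)
      · simp
    | zero => simp
    | add x y _ _ hx hy => rw [map_add, add_sub_add_comm]; exact add_mem hx hy
    | smul c x _ hx =>
      have hc : p₁ (c • x) - c • x = c • (p₁ x - x) := by
        rw [map_smul]
        ext
        simp [mul_sub]
      rw [hc]
      exact Submodule.smul_mem _ _ hx
  set θ := rescale v L₀ (p₁ ∘ₗ q) with hθ
  have hθL : ∀ w, θ (linearForm w) = Polynomial.C (linearForm (w v • L₀)) +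
      Polynomial.X * Polynomial.C (linearForm (p₁ (q w))) := fun w => rescale_linearForm _ _ _ w
  have hθB : ∀ i ∈ B \ A, θ (linearForm (z i)) =
      Polynomial.X * Polynomial.C (linearForm (z i)) := by
    intro i hi
    rw [Finset.mem_sdiff] at hi
    rw [hθL, hqz i hi.1, hp₁ i hi.1, hz i hi.1, if_neg hi.2]
    simp
  have hθA : ∀ i ∈ A, θ (linearForm (z i)) = 0 := by
    intro i hi
    rw [hθL, hqz i (hA hi), hp₁ i (hA hi), hz i (hA hi), if_pos hi]
    simp
  -- The coefficient of `t ^ j` in `θ f` lies in the `j`-th power of the ideal of `B \ A`.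
  have hrees : ∀ f, θ f ∈ reesAlgebra (formsIdeal z (B \ A)) := by
    intro f
    induction f using MvPolynomial.induction_on with
    | C a =>
      rw [← MvPolynomial.algebraMap_eq, AlgHom.commutes, Polynomial.algebraMap_apply]
      exact Subalgebra.algebraMap_mem _ _
    | add f g hf hg => rw [map_add]; exact add_mem hf hg
    | mul_X f j hf =>
      rw [map_mul]
      refine mul_mem hf ?_
      rw [← linearForm_proj, hθL]
      refine add_mem (Subalgebra.algebraMap_mem _ _) ?_
      rw [mul_comm, ← pow_one Polynomial.X, Polynomial.C_mul_X_pow_eq_monomial]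
      refine reesAlgebra.monomial_mem.2 ?_
      rw [pow_one]
      exact linearForm_mem_formsIdeal_of_mem_span (hp_mem _ (hq_mem _))
  -- Setting `t = 1` gives back `f` modulo the forms of `A`.
  have heval : ∀ f, Polynomial.eval 1 (θ f) - f ∈ formsIdeal z A := by
    intro f
    induction f using MvPolynomial.induction_on with
    | C a =>
      rw [← MvPolynomial.algebraMap_eq, AlgHom.commutes, Polynomial.algebraMap_apply]
      simp
    | add f g hf hg =>
      rw [map_add, Polynomial.eval_add, add_sub_add_comm]
      exact add_mem hf hg
    | mul_X f j hf =>
      have hX : Polynomial.eval 1 (θ (MvPolynomial.X j)) - MvPolynomial.X j ∈ formsIdeal z A := by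
        rw [← linearForm_proj, hθL]
        simp only [Polynomial.eval_add, Polynomial.eval_mul, Polynomial.eval_C, Polynomial.eval_X,
          one_mul]
        rw [← map_add, ← map_sub]
        refine linearForm_mem_formsIdeal_of_mem_span ?_
        have := hp_sub _ (hq_mem (LinearMap.proj j))
        convert this using 1
        conv_rhs => rw [hq_apply (LinearMap.proj j)]
        rw [hq_apply]
        abel
      rw [map_mul, Polynomial.eval_mul]
      have hsplit : Polynomial.eval 1 (θ f) * Polynomial.eval 1 (θ (MvPolynomial.X j))
          - f * MvPolynomial.X j =
          (Polynomial.eval 1 (θ f) - f) * Polynomial.eval 1 (θ (MvPolynomial.X j)) +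
          f * (Polynomial.eval 1 (θ (MvPolynomial.X j)) - MvPolynomial.X j) := by ring
      rw [hsplit]
      exact add_mem (Ideal.mul_mem_right _ _ hf) (Ideal.mul_mem_left _ _ hX)
  refine ⟨θ, fun k f => ⟨fun hf => ?_, fun hf => ?_⟩, fun L hL hdvd => ?_, hθB⟩
  · rw [← Ideal.mem_span_singleton, ← Ideal.mem_comap]
    refine (sup_le ?_ ?_ : _ ≤ Ideal.comap θ (Ideal.span {Polynomial.X ^ k})) hf
    · rw [← Ideal.map_le_iff_le_comap, Ideal.map_pow, ← Ideal.span_singleton_pow]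
      refine Ideal.pow_right_mono ?_ k
      rw [formsIdeal, Ideal.map_span, Ideal.span_le]
      rintro _ ⟨_, ⟨i, hi, rfl⟩, rfl⟩
      rw [SetLike.mem_coe, Ideal.mem_span_singleton]
      exact ⟨_, hθB i hi⟩
    · rw [formsIdeal, Ideal.span_le]
      rintro _ ⟨i, hi, rfl⟩
      rw [SetLike.mem_coe, Ideal.mem_comap]
      rw [hθA i hi]
      exact zero_mem _
  · have h1 : Polynomial.eval 1 (θ f) ∈ formsIdeal z (B \ A) ^ k := by
      rw [Polynomial.eval_eq_sum, Polynomial.sum]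
      refine Submodule.sum_mem _ fun j hj => ?_
      rw [one_pow, mul_one]
      have hjk : k ≤ j := by
        by_contra! hlt
        exact Polynomial.mem_support_iff.1 hj (Polynomial.X_pow_dvd_iff.1 hf j hlt)
      exact Ideal.pow_le_pow_right hjk ((mem_reesAlgebra_iff _ _).1 (hrees f) j)
    have h2 : f = Polynomial.eval 1 (θ f) + -(Polynomial.eval 1 (θ f) - f) := by ring
    rw [h2]
    exact add_mem (Ideal.mem_sup_left h1) (Ideal.mem_sup_right (neg_mem (heval f)))
  · rw [hθL, Polynomial.X_dvd_iff] at hdvd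
    have h0 : linearForm (L v • L₀) = 0 := by simpa using hdvd
    refine linearForm_ne_zero (v := v) ?_ h0
    simpa [hL₀] using hL

variable [DecidableEq κ]

theorem CutsOutPoint.mem_of_linearForm_mul_mem (h : CutsOutPoint z B v) {A : Finset κ}
    (hA : A ⊆ B) {L : Module.Dual K (σ → K)} (hL : L v ≠ 0) {k : ℕ} {f : MvPolynomial σ K}
    (hf : linearForm L * f ∈ formsIdeal z (B \ A) ^ k ⊔ formsIdeal z A) :
    f ∈ formsIdeal z (B \ A) ^ k ⊔ formsIdeal z A := by
  obtain ⟨θ, hθ, hθL, -⟩ := h.exists_rescale hA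
  rw [hθ, map_mul] at hf
  rw [hθ]
  exact Polynomial.prime_X.pow_dvd_of_dvd_mul_left k (hθL L hL) hf

theorem CutsOutPoint.mem_of_form_mul_mem (h : CutsOutPoint z B v) {A : Finset κ}
    (hA : A ⊆ B) {i : κ} (hi : i ∈ B \ A) {k : ℕ} {f : MvPolynomial σ K}
    (hf : linearForm (z i) * f ∈ formsIdeal z (B \ A) ^ k ⊔ formsIdeal z A) :
    f ∈ formsIdeal z (B \ A) ^ (k - 1) ⊔ formsIdeal z A := by
  rcases k with _ | k
  · simp
  obtain ⟨θ, hθ, -, hθB⟩ := h.exists_rescale hA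
  rw [hθ, map_mul, hθB i hi, pow_succ', mul_assoc,
    mul_dvd_mul_iff_left Polynomial.X_ne_zero] at hf
  rw [Nat.add_sub_cancel, hθ]
  refine Polynomial.prime_X.pow_dvd_of_dvd_mul_left k ?_ hf
  rw [Polynomial.X_dvd_iff, Polynomial.coeff_C_zero]
  intro h0
  have hzi : z i ≠ 0 := h.indep.ne_zero (Finset.mem_sdiff.1 hi).1
  obtain ⟨u, hu⟩ : ∃ u, z i u ≠ 0 := by
    by_contra! hc
    exact hzi (LinearMap.ext hc)
  exact linearForm_ne_zero hu h0

/-- The powers of the ideal of a point are primary. -/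
theorem CutsOutPoint.mem_pow_of_mul_mem (h : CutsOutPoint z B v) {k : ℕ} {s f : MvPolynomial σ K}
    (hs : s ∉ formsIdeal z B) (hf : s * f ∈ formsIdeal z B ^ k) : f ∈ formsIdeal z B ^ k := by
  obtain ⟨θ, hθ, -, -⟩ := h.exists_rescale (Finset.empty_subset B)
  simp only [Finset.sdiff_empty, formsIdeal_empty, sup_bot_eq] at hθ
  rw [hθ, map_mul] at hf
  rw [hθ]
  refine Polynomial.prime_X.pow_dvd_of_dvd_mul_left k (fun hX => hs ?_) hf
  rw [← pow_one (formsIdeal z B), hθ, pow_one]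
  exact hX

theorem CutsOutPoint.isPrime (h : CutsOutPoint z B v) : (formsIdeal z B).IsPrime := by
  refine ⟨fun htop => ?_, fun {s f} hsf => ?_⟩
  · have := h.eval_eq_zero (f := 1) (by rw [htop]; trivial)
    simp at this
  · by_contra! hc
    refine hc.2 ?_
    have := h.mem_pow_of_mul_mem (k := 1) hc.1 (by simpa using hsf)
    simpa using this

end Order

/-! ### Intersections of powers are generated by monomials in the forms -/

theorem sup_pow_le_sup {R : Type*} [CommRing R] (I J : Ideal R) (k : ℕ) :
    (I ⊔ J) ^ k ≤ I ⊔ J ^ k := by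
  induction k with
  | zero => simp
  | succ k ih =>
    rw [pow_succ, pow_succ]
    have h1 : I * (I ⊔ J) ≤ I := Ideal.mul_le_left
    have h2 : J ^ k * I ≤ I := Ideal.mul_le_right
    refine (Ideal.mul_mono_left ih).trans ?_
    rw [Ideal.sup_mul, Ideal.mul_sup (J ^ k)]
    exact sup_le (h1.trans le_sup_left) (sup_le (h2.trans le_sup_left) le_sup_right)

section Monomials

variable {K σ κ : Type*} [Field K] [Fintype σ] [DecidableEq σ] {z : κ → Module.Dual K (σ → K)}

theorem prod_pow_mem_formsIdeal_pow (T : Finset κ) (a : κ → ℕ) :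
    ∏ i ∈ T, linearForm (z i) ^ a i ∈ formsIdeal z T ^ ∑ i ∈ T, a i := by
  rw [← Finset.prod_pow_eq_pow_sum]
  exact Ideal.prod_mem_prod fun i hi => Ideal.pow_mem_pow (linearForm_mem_formsIdeal z hi) _

theorem formsIdeal_pow_sup_le [DecidableEq κ] {A B : Finset κ} {i : κ} (hi : i ∉ A)
    (hiB : i ∈ B) (k : ℕ) :
    formsIdeal z (B \ A) ^ k ⊔ formsIdeal z A ≤
      formsIdeal z (B \ insert i A) ^ k ⊔ formsIdeal z (insert i A) := by
  have hins : B \ A = insert i (B \ insert i A) := by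
    ext x
    simp only [Finset.mem_sdiff, Finset.mem_insert]
    by_cases hx : x = i
    · subst hx; simp [hiB, hi]
    · simp [hx]
  refine sup_le ?_ ((formsIdeal_mono z (Finset.subset_insert i A)).trans le_sup_right)
  conv_lhs => rw [hins, formsIdeal_insert]
  refine (sup_pow_le_sup _ _ k).trans (sup_le ?_ le_sup_left)
  rw [formsIdeal_insert]
  exact le_sup_left.trans le_sup_right

variable [Fintype κ]

/-- The product of the powers `z i ^ a i` of linear forms. -/
noncomputable def formMonomial (z : κ → Module.Dual K (σ → K)) (a : κ → ℕ) : MvPolynomial σ K :=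
  ∏ i, linearForm (z i) ^ a i

theorem formMonomial_mem_formsIdeal_pow (T : Finset κ) (a : κ → ℕ) :
    formMonomial z a ∈ formsIdeal z T ^ ∑ i ∈ T, a i := by
  classical
  rw [formMonomial, ← Finset.prod_sdiff (Finset.subset_univ T)]
  exact Ideal.mul_mem_left _ _ (prod_pow_mem_formsIdeal_pow T a)

theorem formMonomial_add_single [DecidableEq κ] (a : κ → ℕ) (i : κ) :
    formMonomial z (a + Pi.single i 1) = linearForm (z i) * formMonomial z a := by
  simp only [formMonomial, Pi.add_apply, pow_add, Finset.prod_mul_distrib]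
  rw [mul_comm]
  congr 1
  rw [Finset.prod_eq_single i]
  · simp
  · intro j _ hj
    simp [hj]
  · simp

variable [DecidableEq κ]

/-- The ideal of all monomials in the forms `z` whose exponents, shifted by the weight `c`, sum
to at least `m` over `B \ A` for each member `B ⊇ A` of the family `ℬ`. -/
noncomputable def monomialsIdeal (z : κ → Module.Dual K (σ → K)) (ℬ : Set (Finset κ))
    (A : Finset κ) (m : ℕ) (c : κ → ℕ) : Ideal (MvPolynomial σ K) :=
  Ideal.span {g | ∃ a : κ → ℕ, (∀ B ∈ ℬ, A ⊆ B → m ≤ ∑ i ∈ B \ A, (a i + c i)) ∧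
    g = formMonomial z a}

variable {ℬ : Set (Finset κ)} {A : Finset κ} {m : ℕ} {c : κ → ℕ}

theorem monomialsIdeal_eq_top (h : ∀ B ∈ ℬ, A ⊆ B → m ≤ ∑ i ∈ B \ A, c i) :
    monomialsIdeal z ℬ A m c = ⊤ := by
  rw [Ideal.eq_top_iff_one]
  exact Ideal.subset_span ⟨0, by simpa using h, by simp [formMonomial]⟩

theorem monomialsIdeal_le_pow {B : Finset κ} (hB : B ∈ ℬ) (hA : A ⊆ B) :
    monomialsIdeal z ℬ A m c ≤ formsIdeal z (B \ A) ^ (m - ∑ i ∈ B \ A, c i) := by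
  rw [monomialsIdeal, Ideal.span_le]
  rintro _ ⟨a, ha, rfl⟩
  refine Ideal.pow_le_pow_right ?_ (formMonomial_mem_formsIdeal_pow (B \ A) a)
  have := ha B hB hA
  rw [Finset.sum_add_distrib] at this
  omega

theorem mul_mem_monomialsIdeal {i : κ} {f : MvPolynomial σ K}
    (hf : f ∈ monomialsIdeal z ℬ A m (c + Pi.single i 1)) :
    linearForm (z i) * f ∈ monomialsIdeal z ℬ A m c := by
  have hle : monomialsIdeal z ℬ A m (c + Pi.single i 1) ≤
      Submodule.comap (LinearMap.mulLeft _ (linearForm (z i))) (monomialsIdeal z ℬ A m c) := by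
    rw [monomialsIdeal, Ideal.span_le]
    rintro _ ⟨a, ha, rfl⟩
    refine Ideal.subset_span ⟨a + Pi.single i 1, fun B hB hAB => ?_, ?_⟩
    · refine (ha B hB hAB).trans_eq (Finset.sum_congr rfl fun j _ => ?_)
      simp only [Pi.add_apply]
      ring
    · rw [formMonomial_add_single]
      rfl
  exact hle hf

/-- If the weight of `i` is minimal among the elements that lie outside `A` and in a member of `ℬ`
containing `A`, then a monomial that is admissible for the link of `i` is admissible. -/
theorem monomialsIdeal_insert_le
    (hexch : ∀ B ∈ ℬ, ∀ B' ∈ ℬ, ∀ i ∈ B', i ∉ B →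
      ∃ j ∈ B, j ∉ B' ∧ insert i (B.erase j) ∈ ℬ)
    {i : κ} (hi : i ∉ A) {B₀ : Finset κ} (hB₀ : B₀ ∈ ℬ) (hiB₀ : i ∈ B₀) (hAB₀ : A ⊆ B₀)
    (hmin : ∀ B ∈ ℬ, A ⊆ B → ∀ j ∈ B, j ∉ A → c i ≤ c j) :
    monomialsIdeal z ℬ (insert i A) (m - c i) c ≤ monomialsIdeal z ℬ A m c := by
  refine Ideal.span_mono ?_
  rintro _ ⟨a, ha, rfl⟩
  refine ⟨a, fun B hB hAB => ?_, rfl⟩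
  by_cases hiB : i ∈ B
  · have h1 := ha B hB (Finset.insert_subset hiB hAB)
    rw [Finset.sdiff_insert] at h1
    have h2 := Finset.add_sum_erase (B \ A) (fun i => a i + c i) (Finset.mem_sdiff.2 ⟨hiB, hi⟩)
    omega
  · obtain ⟨j, hjB, hjB₀, hB'⟩ := hexch B hB B₀ hB₀ i hiB₀ hiB
    have hjA : j ∉ A := fun h => hjB₀ (hAB₀ h)
    have hsub : insert i A ⊆ insert i (B.erase j) := by
      refine Finset.insert_subset_insert i fun x hx => Finset.mem_erase.2 ⟨?_, hAB hx⟩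
      rintro rfl
      exact hjA hx
    have h1 := ha _ hB' hsub
    have hset : insert i (B.erase j) \ insert i A = (B \ A).erase j := by
      ext x
      simp only [Finset.mem_sdiff, Finset.mem_insert, Finset.mem_erase]
      constructor
      · rintro ⟨h | h, h'⟩
        · exact absurd (Or.inl h) h'
        · exact ⟨h.1, h.2, fun hx => h' (Or.inr hx)⟩
      · rintro ⟨hxj, hxB, hxA⟩
        refine ⟨Or.inr ⟨hxj, hxB⟩, ?_⟩
        rintro (rfl | h)
        · exact hiB hxB
        · exact hxA h
    rw [hset] at h1
    have h2 := Finset.add_sum_erase (B \ A) (fun i => a i + c i) (Finset.mem_sdiff.2 ⟨hjB, hjA⟩)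
    have h3 := hmin B hB hAB j hjB hjA
    omega

/-- For a matroid of linear forms whose bases cut out points, the intersection of powers of the
ideals of these points is generated by monomials in the forms. The general statement, with the
forms of `A` set to zero and weights `c`, is what the induction needs. -/
theorem mem_monomialsIdeal_sup
    (hℬ : ∀ B ∈ ℬ, ∃ v, CutsOutPoint z B v ∧ ∀ i ∉ B, z i v ≠ 0)
    (hexch : ∀ B ∈ ℬ, ∀ B' ∈ ℬ, ∀ i ∈ B', i ∉ B →
      ∃ j ∈ B, j ∉ B' ∧ insert i (B.erase j) ∈ ℬ)
    (A : Finset κ) (m : ℕ) (c : κ → ℕ) (f : MvPolynomial σ K)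
    (hf : ∀ B ∈ ℬ, A ⊆ B →
      f ∈ formsIdeal z (B \ A) ^ (m - ∑ i ∈ B \ A, c i) ⊔ formsIdeal z A) :
    f ∈ monomialsIdeal z ℬ A m c ⊔ formsIdeal z A := by
  induction hn : Aᶜ.card using Nat.strong_induction_on generalizing A m c f with
  | _ n ih =>
  induction hw : ∑ i, (m - c i) using Nat.strong_induction_on generalizing c f with
  | _ w ihw =>
  by_cases htop : ∀ B ∈ ℬ, A ⊆ B → m ≤ ∑ i ∈ B \ A, c i
  · rw [monomialsIdeal_eq_top htop, top_sup_eq]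
    trivial
  by_cases hAℬ : A ∈ ℬ
  · have h := hf A hAℬ subset_rfl
    rw [Finset.sdiff_self, Finset.sum_empty, formsIdeal_empty, Nat.sub_zero] at h
    have hm : m ≠ 0 := by
      rintro rfl
      exact htop fun _ _ _ => Nat.zero_le _
    rw [← Ideal.zero_eq_bot, zero_pow hm, Ideal.zero_eq_bot, bot_sup_eq] at h
    exact Ideal.mem_sup_right h
  -- The new form `i` has minimal weight among those outside `A` that lie in a basis containing `A`.
  obtain ⟨B₁, hB₁, hAB₁, hlt⟩ : ∃ B ∈ ℬ, A ⊆ B ∧ ∑ i ∈ B \ A, c i < m := by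
    push Not at htop
    exact htop
  obtain ⟨i, hi, B₀, hB₀, hAB₀, hiB₀, hmin⟩ : ∃ i, i ∉ A ∧ ∃ B₀ ∈ ℬ, A ⊆ B₀ ∧ i ∈ B₀ ∧
      ∀ B ∈ ℬ, A ⊆ B → ∀ j ∈ B, j ∉ A → c i ≤ c j := by
    classical
    obtain ⟨i₁, hi₁, hi₁A⟩ : ∃ i ∈ B₁, i ∉ A := by
      by_contra! hc
      exact hAℬ (hAB₁.antisymm hc ▸ hB₁)
    obtain ⟨i, hi, hmin⟩ := Finset.exists_min_image
      (Finset.univ.filter fun i => i ∉ A ∧ ∃ B ∈ ℬ, A ⊆ B ∧ i ∈ B) c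
      ⟨i₁, by simpa using ⟨hi₁A, B₁, hB₁, hAB₁, hi₁⟩⟩
    obtain ⟨hiA, B₀, hB₀, hAB₀, hiB₀⟩ := (Finset.mem_filter.1 hi).2
    refine ⟨i, hiA, B₀, hB₀, hAB₀, hiB₀, fun B hB hAB j hj hjA => hmin j ?_⟩
    simpa using ⟨hjA, B, hB, hAB, hj⟩
  have hcim : c i < m := by
    obtain ⟨j, hj, hjA⟩ : ∃ i ∈ B₁, i ∉ A := by
      by_contra! hc
      exact hAℬ (hAB₁.antisymm hc ▸ hB₁)
    calc c i ≤ c j := hmin B₁ hB₁ hAB₁ j hj hjA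
      _ ≤ ∑ i ∈ B₁ \ A, c i :=
        Finset.single_le_sum (fun _ _ => Nat.zero_le _) (Finset.mem_sdiff.2 ⟨hj, hjA⟩)
      _ < m := hlt
  -- Restriction to the hyperplane `z i = 0`.
  have hrestr : f ∈ monomialsIdeal z ℬ (insert i A) (m - c i) c ⊔ formsIdeal z (insert i A) := by
    refine ih _ ?_ (insert i A) (m - c i) c f (fun B hB hAB => ?_) rfl
    · rw [← hn]
      refine Finset.card_lt_card (Finset.compl_ssubset_compl.2 (Finset.ssubset_insert hi))
    · have hiB : i ∈ B := hAB (Finset.mem_insert_self i A)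
      have hAB' : A ⊆ B := (Finset.subset_insert i A).trans hAB
      have h1 := formsIdeal_pow_sup_le hi hiB _ (hf B hB hAB')
      have h2 := Finset.add_sum_erase (B \ A) c (Finset.mem_sdiff.2 ⟨hiB, hi⟩)
      rw [← Finset.sdiff_insert] at h2
      rwa [← h2, ← Nat.sub_sub] at h1
  obtain ⟨g, hg, q, hq, hgq⟩ := Submodule.mem_sup.1 hrestr
  replace hg := monomialsIdeal_insert_le hexch hi hB₀ hiB₀ hAB₀ hmin hg
  rw [formsIdeal_insert] at hq
  obtain ⟨q₁, hq₁, q₂, hq₂, hq12⟩ := Submodule.mem_sup.1 hq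
  obtain ⟨h, rfl⟩ := Ideal.mem_span_singleton.1 hq₁
  -- The difference of `f` and its lift is `z i * h`, and `h` satisfies the hypothesis for the
  -- weight increased by one at `i`.
  have hh : h ∈ monomialsIdeal z ℬ A m (c + Pi.single i 1) ⊔ formsIdeal z A := by
    refine ihw _ ?_ (c + Pi.single i 1) h (fun B hB hAB => ?_) rfl
    · rw [← hw]
      refine Finset.sum_lt_sum (fun j _ => ?_) ⟨i, Finset.mem_univ i, ?_⟩
      · simp only [Pi.add_apply]
        omega
      · simp only [Pi.add_apply, Pi.single_eq_same]
        omega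
    · obtain ⟨v, hv, hv'⟩ := hℬ B hB
      have hzh : linearForm (z i) * h ∈
          formsIdeal z (B \ A) ^ (m - ∑ i ∈ B \ A, c i) ⊔ formsIdeal z A := by
        have heq : linearForm (z i) * h = f + -(g + q₂) := by
          rw [← hgq, ← hq12]
          ring
        rw [heq]
        exact add_mem (hf B hB hAB) (neg_mem (add_mem
          (Ideal.mem_sup_left (monomialsIdeal_le_pow hB hAB hg)) (Ideal.mem_sup_right hq₂)))
      simp only [Pi.add_apply, Finset.sum_add_distrib, Finset.sum_pi_single']
      by_cases hiB : i ∈ B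
      · have hi' : i ∈ B \ A := Finset.mem_sdiff.2 ⟨hiB, hi⟩
        rw [if_pos hi', ← Nat.sub_sub]
        exact hv.mem_of_form_mul_mem hAB hi' hzh
      · rw [if_neg fun h => hiB (Finset.mem_sdiff.1 h).1, add_zero]
        exact hv.mem_of_linearForm_mul_mem hAB (hv' i hiB) hzh
  obtain ⟨h₁, hh₁, h₂, hh₂, rfl⟩ := Submodule.mem_sup.1 hh
  rw [← hgq, ← hq12, mul_add]
  exact add_mem (Ideal.mem_sup_left hg) (add_mem (add_mem
    (Ideal.mem_sup_left (mul_mem_monomialsIdeal hh₁))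
    (Ideal.mem_sup_right (Ideal.mul_mem_left _ _ hh₂))) (Ideal.mem_sup_right hq₂))

/-- An element of the `m`-th power of the ideal of every point is a combination of monomials in
the forms that have order at least `m` at every point. -/
theorem mem_span_formMonomial
    (hℬ : ∀ B ∈ ℬ, ∃ v, CutsOutPoint z B v ∧ ∀ i ∉ B, z i v ≠ 0)
    (hexch : ∀ B ∈ ℬ, ∀ B' ∈ ℬ, ∀ i ∈ B', i ∉ B →
      ∃ j ∈ B, j ∉ B' ∧ insert i (B.erase j) ∈ ℬ)
    {f : MvPolynomial σ K} (hf : ∀ B ∈ ℬ, f ∈ formsIdeal z B ^ m) :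
    f ∈ Ideal.span {g | ∃ a : κ → ℕ, (∀ B ∈ ℬ, m ≤ ∑ i ∈ B, a i) ∧ g = formMonomial z a} := by
  have h := mem_monomialsIdeal_sup hℬ hexch ∅ m 0 f (by simpa using hf)
  simpa [monomialsIdeal] using h

end Monomials

/-! ### Factoring monomials of high order -/

section Combinatorics

theorem exists_card_eq_forall_le {X : Type*} [Fintype X] [DecidableEq X] {N : ℕ}
    (hN : N ≤ Fintype.card X) (a : X → ℕ) :
    ∃ S : Finset X, S.card = N ∧ ∀ i ∈ S, ∀ j ∉ S, a i ≤ a j := by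
  have hne : (Finset.powersetCard N (Finset.univ : Finset X)).Nonempty :=
    Finset.powersetCard_nonempty.2 (by simpa using hN)
  obtain ⟨S, hS, hmin⟩ := Finset.exists_min_image _ (fun S => ∑ i ∈ S, a i) hne
  have hSc : S.card = N := (Finset.mem_powersetCard.1 hS).2
  refine ⟨S, hSc, fun i hi j hj => ?_⟩
  have hj' : j ∉ S.erase i := fun h => hj (Finset.mem_of_mem_erase h)
  have h1 := hmin (insert j (S.erase i)) (Finset.mem_powersetCard.2 ⟨Finset.subset_univ _, by
    rw [Finset.card_insert_of_notMem hj', Finset.card_erase_add_one hi, hSc]⟩)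
  have h2 := Finset.add_sum_erase S a hi
  rw [Finset.sum_insert hj'] at h1
  omega

variable {R X Y : Type*} [CommRing R] [Fintype X] [DecidableEq X] [Fintype Y]

theorem prod_pow_mem_pow_sum {ι : Type*} {M : Ideal R} {x : ι → R} (hx : ∀ i, x i ∈ M)
    (T : Finset ι) (a : ι → ℕ) : ∏ i ∈ T, x i ^ a i ∈ M ^ ∑ i ∈ T, a i := by
  rw [← Finset.prod_pow_eq_pow_sum]
  exact Ideal.prod_mem_prod fun i _ => Ideal.pow_mem_pow (hx i) _

/-- Let the products of `|X| - N + 1` distinct `x i` and the `y j` lie in `I`. A monomial in which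
any `N` exponents of the `x i` and all exponents of the `y j` add up to at least
`m ≥ (r - 1) d + 1` lies in `M ^ (m - r) * I ^ r`. -/
theorem prod_mul_prod_mem {N d m r : ℕ} (hNd : N < d) (hN : N ≤ Fintype.card X) (hr : 1 ≤ r)
    (hm : (r - 1) * d + 1 ≤ m) {M I : Ideal R} {x : X → R} {y : Y → R} (hx : ∀ i, x i ∈ M)
    (hyM : ∀ j, y j ∈ M) (hyI : ∀ j, y j ∈ I)
    (hG : ∀ G : Finset X, G.card = Fintype.card X - N + 1 → ∏ i ∈ G, x i ∈ I)
    (a : X → ℕ) (b : Y → ℕ)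
    (hab : ∀ S : Finset X, S.card = N → m ≤ ∑ i ∈ S, a i + ∑ j, b j) :
    (∏ i, x i ^ a i) * ∏ j, y j ^ b j ∈ M ^ (m - r) * I ^ r := by
  obtain ⟨S, hS, hSmin⟩ := exists_card_eq_forall_le hN a
  have habS := hab S hS
  set k := ∑ j, b j with hk
  rcases le_or_gt r k with hrk | hkr
  · -- The `y j` alone supply the `r` factors from `I`.
    have hy : ∏ j, y j ^ b j ∈ M ^ (k - r) * I ^ r := by
      have h1 : ∏ j, y j ^ b j ∈ (M ⊓ I) ^ k :=
        prod_pow_mem_pow_sum (M := M ⊓ I) (fun j => Submodule.mem_inf.2 ⟨hyM j, hyI j⟩) _ _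
      rw [← Nat.sub_add_cancel hrk, pow_add] at h1
      exact Ideal.mul_mono (Ideal.pow_right_mono inf_le_left _)
        (Ideal.pow_right_mono inf_le_right _) h1
    have h2 := Ideal.mul_mem_mul (prod_pow_mem_pow_sum hx Finset.univ a) hy
    rw [← mul_assoc, ← pow_add] at h2
    refine Ideal.mul_mono_left (Ideal.pow_le_pow_right ?_) h2
    have := Finset.sum_le_sum_of_subset (f := a) (Finset.subset_univ S)
    omega
  · have hS0 : S.Nonempty := by
      rw [Finset.nonempty_iff_ne_empty]
      rintro rfl
      have : r - 1 ≤ (r - 1) * d := Nat.le_mul_of_pos_right _ (by omega)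
      simp only [Finset.sum_empty] at habS
      omega
    obtain ⟨i₀, hi₀, hmax⟩ := Finset.exists_max_image S a hS0
    -- The `N`-th smallest exponent is at least `r - k`, the number of factors still needed.
    have hai₀ : r - k ≤ a i₀ := by
      by_contra! hlt
      have h1 : ∑ i ∈ S, a i ≤ N * a i₀ := by
        rw [← hS, ← smul_eq_mul]
        exact Finset.sum_le_card_nsmul _ _ _ hmax
      have h2 : N * (a i₀ + k) ≤ N * (r - 1) := Nat.mul_le_mul_left _ (by omega)
      have h3 : (r - 1) * N ≤ (r - 1) * d := Nat.mul_le_mul_left _ hNd.le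
      have h4 : k ≤ N * k := Nat.le_mul_of_pos_left _ (hS ▸ hS0.card_pos)
      rw [mul_add, mul_comm N (r - 1)] at h2
      omega
    have hnot : i₀ ∉ Sᶜ := by simpa using hi₀
    have hSx : ∏ i ∈ S.erase i₀, x i ^ a i ∈ M ^ ∑ i ∈ S.erase i₀, a i :=
      prod_pow_mem_pow_sum hx _ _
    have hix : x i₀ ^ (a i₀ - (r - k)) ∈ M ^ (a i₀ - (r - k)) := Ideal.pow_mem_pow (hx i₀) _
    have hGx : (∏ i ∈ insert i₀ Sᶜ, x i) ^ (r - k) ∈ I ^ (r - k) := by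
      refine Ideal.pow_mem_pow (hG _ ?_) _
      rw [Finset.card_insert_of_notMem hnot, Finset.card_compl, hS]
    have hy : ∏ j, y j ^ b j ∈ I ^ k := prod_pow_mem_pow_sum hyI _ _
    have hfac : (∏ i, x i ^ a i) * ∏ j, y j ^ b j =
        (∏ i ∈ Sᶜ, x i ^ (a i - (r - k))) *
          (((∏ i ∈ S.erase i₀, x i ^ a i) * x i₀ ^ (a i₀ - (r - k))) *
            ((∏ i ∈ insert i₀ Sᶜ, x i) ^ (r - k) * ∏ j, y j ^ b j)) := by
      have h1 : ∏ i ∈ Sᶜ, x i ^ a i =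
          (∏ i ∈ Sᶜ, x i ^ (a i - (r - k))) * (∏ i ∈ Sᶜ, x i) ^ (r - k) := by
        rw [← Finset.prod_pow, ← Finset.prod_mul_distrib]
        refine Finset.prod_congr rfl fun i hi => ?_
        rw [← pow_add, Nat.sub_add_cancel
          (hai₀.trans (hSmin i₀ hi₀ i (by simpa using hi)))]
      have h2 : x i₀ ^ a i₀ = x i₀ ^ (a i₀ - (r - k)) * x i₀ ^ (r - k) := by
        rw [← pow_add, Nat.sub_add_cancel hai₀]
      rw [← Finset.prod_mul_prod_compl S, ← Finset.mul_prod_erase S _ hi₀, h1, h2,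
        Finset.prod_insert hnot, mul_pow]
      ring
    rw [hfac]
    refine Ideal.mul_mem_left _ _ ?_
    have h1 := Ideal.mul_mem_mul (Ideal.mul_mem_mul hSx hix) (Ideal.mul_mem_mul hGx hy)
    rw [← pow_add, ← pow_add, Nat.sub_add_cancel hkr.le] at h1
    refine Ideal.mul_mono_left (Ideal.pow_le_pow_right ?_) h1
    have := Finset.add_sum_erase S a hi₀
    omega

end Combinatorics

/-! ### Symbolic powers of the ideal of a matroid configuration -/

section SymbolicPower

variable {K σ κ : Type*} [Field K] [Fintype σ] [DecidableEq σ] [Fintype κ] [DecidableEq κ]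
  {z : κ → Module.Dual K (σ → K)} {ℬ : Set (Finset κ)}

/-- The ideal of each point is an associated prime of the intersection: it is the annihilator of
the product of all forms that do not vanish at that point. -/
theorem formsIdeal_mem_associatedPrimes
    (hℬ : ∀ B ∈ ℬ, ∃ v, CutsOutPoint z B v ∧ ∀ i ∉ B, z i v ≠ 0)
    (hexch : ∀ B ∈ ℬ, ∀ B' ∈ ℬ, ∀ i ∈ B', i ∉ B →
      ∃ j ∈ B, j ∉ B' ∧ insert i (B.erase j) ∈ ℬ)
    {I : Ideal (MvPolynomial σ K)} (hI : ∀ f, f ∈ I ↔ ∀ B ∈ ℬ, f ∈ formsIdeal z B)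
    {B : Finset κ} (hB : B ∈ ℬ) :
    formsIdeal z B ∈ associatedPrimes (MvPolynomial σ K) (MvPolynomial σ K ⧸ I) := by
  obtain ⟨v, hv, hv'⟩ := hℬ B hB
  have hprime := hv.isPrime
  rw [AssociatedPrimes.mem_iff, isAssociatedPrime_iff]
  set w : MvPolynomial σ K := ∏ i ∈ Bᶜ, linearForm (z i) with hw
  have hwB : w ∉ formsIdeal z B := by
    rw [hw, hprime.prod_mem_iff]
    rintro ⟨i, hi, hiB⟩
    have h0 := hv.eval_eq_zero hiB
    rw [eval_linearForm] at h0
    exact hv' i (by simpa using hi) h0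
  have hwB' : ∀ B' ∈ ℬ, B' ≠ B → w ∈ formsIdeal z B' := by
    intro B' hB' hne
    obtain ⟨j, hj, hjB⟩ : ∃ j ∈ B', j ∉ B := by
      by_contra! hc
      obtain ⟨i, hi, hiB'⟩ := Finset.exists_of_ssubset (Finset.ssubset_iff_subset_ne.2 ⟨hc, hne⟩)
      obtain ⟨j, hj, hjB, -⟩ := hexch B' hB' B hB i hi hiB'
      exact hjB (hc j hj)
    exact Ideal.mem_of_dvd _ (Finset.dvd_prod_of_mem _ (Finset.mem_compl.2 hjB))
      (linearForm_mem_formsIdeal z hj)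
  refine ⟨hprime, Ideal.Quotient.mk I w, ?_⟩
  ext f
  rw [Submodule.mem_colon_singleton, Submodule.mem_bot, ← Ideal.Quotient.mk_eq_mk,
    ← Submodule.Quotient.mk_smul, smul_eq_mul, Ideal.Quotient.mk_eq_mk,
    Ideal.Quotient.eq_zero_iff_mem, hI]
  constructor
  · intro hf B' hB'
    by_cases h : B' = B
    · subst h
      exact Ideal.mul_mem_right _ _ hf
    · exact Ideal.mul_mem_left _ _ (hwB' B' hB' h)
  · intro hf
    exact (hprime.mem_or_mem (hf B hB)).resolve_right hwB

theorem symbolicPower_le_formsIdeal_pow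
    (hℬ : ∀ B ∈ ℬ, ∃ v, CutsOutPoint z B v ∧ ∀ i ∉ B, z i v ≠ 0)
    (hexch : ∀ B ∈ ℬ, ∀ B' ∈ ℬ, ∀ i ∈ B', i ∉ B →
      ∃ j ∈ B, j ∉ B' ∧ insert i (B.erase j) ∈ ℬ)
    {I : Ideal (MvPolynomial σ K)} (hI : ∀ f, f ∈ I ↔ ∀ B ∈ ℬ, f ∈ formsIdeal z B)
    {B : Finset κ} (hB : B ∈ ℬ) (m : ℕ) : symbolicPower I m ≤ formsIdeal z B ^ m := by
  intro f hf
  obtain ⟨v, hv, -⟩ := hℬ B hB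
  obtain ⟨s, hs, hsf⟩ := hf _ (formsIdeal_mem_associatedPrimes hℬ hexch hI hB)
  exact hv.mem_pow_of_mul_mem hs (Ideal.pow_right_mono (fun g hg => (hI g).1 hg B hB) m hsf)

end SymbolicPower

/-! ### Star configurations in a linear subspace -/

section Star

variable {X Y : Type*} [DecidableEq X] [Fintype Y] [DecidableEq Y]

/-- The sets that consist of `N` elements of `X` and of all elements of `Y`. -/
def starBases (X Y : Type*) [Fintype Y] (N : ℕ) : Set (Finset (X ⊕ Y)) :=
  {B | ∃ S : Finset X, S.card = N ∧ B = S.disjSum Finset.univ}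

theorem starBases_exchange {N : ℕ} : ∀ B ∈ starBases X Y N, ∀ B' ∈ starBases X Y N,
    ∀ i ∈ B', i ∉ B → ∃ j ∈ B, j ∉ B' ∧ insert i (B.erase j) ∈ starBases X Y N := by
  rintro _ ⟨S, hS, rfl⟩ _ ⟨S', hS', rfl⟩ i hi hiS
  obtain i | i := i
  · simp only [Finset.inl_mem_disjSum] at hi hiS
    obtain ⟨j, hj, hj'⟩ : ∃ j ∈ S, j ∉ S' := by
      by_contra! hc
      exact hiS (Finset.eq_of_subset_of_card_le hc (hS'.trans hS.symm).le ▸ hi)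
    refine ⟨Sum.inl j, by simpa using hj, by simpa using hj', insert i (S.erase j), ?_, ?_⟩
    · rw [Finset.card_insert_of_notMem fun h => hiS (Finset.mem_of_mem_erase h),
        Finset.card_erase_add_one hj, hS]
    · ext x
      obtain x | x := x <;> simp
  · simp at hiS

variable {K σ : Type*} [Field K] [Fintype σ] [DecidableEq σ] [Fintype X]

/-- Symbolic powers of the ideal `I` of the points that are cut out by `N` of the forms `z (inl i)`
together with all of the forms `z (inr j)`. -/
theorem symbolicPower_le_of_starBases {N d m r : ℕ} (hNd : N < d) (hN : N ≤ Fintype.card X)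
    (hr : 1 ≤ r) (hm : (r - 1) * d + 1 ≤ m) {z : X ⊕ Y → Module.Dual K (σ → K)}
    (hℬ : ∀ B ∈ starBases X Y N, ∃ v, CutsOutPoint z B v ∧ ∀ i ∉ B, z i v ≠ 0)
    {I : Ideal (MvPolynomial σ K)}
    (hI : ∀ f, f ∈ I ↔ ∀ B ∈ starBases X Y N, f ∈ formsIdeal z B) :
    symbolicPower I m ≤ Ideal.span (Set.range MvPolynomial.X) ^ (m - r) * I ^ r := by
  intro f hf
  have hspan := mem_span_formMonomial hℬ starBases_exchange fun B hB =>
    symbolicPower_le_formsIdeal_pow hℬ starBases_exchange hI hB m hf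
  refine Ideal.span_le.2 ?_ hspan
  rintro _ ⟨a, ha, rfl⟩
  rw [SetLike.mem_coe, formMonomial, Fintype.prod_sum_type]
  refine prod_mul_prod_mem hNd hN hr hm (fun i => linearForm_mem_span_X _)
    (fun j => linearForm_mem_span_X _) (fun j => ?_) (fun G hG => ?_) (fun i => a (Sum.inl i))
    (fun j => a (Sum.inr j)) (fun S hS => ?_)
  · rw [hI]
    rintro _ ⟨S, -, rfl⟩
    exact linearForm_mem_formsIdeal z (by simp)
  · rw [hI]
    rintro _ ⟨S, hS, rfl⟩
    -- Since `|S| + |G| > |X|`, the two sets meet.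
    obtain ⟨i, hi, hiS⟩ : ∃ i ∈ G, i ∈ S := by
      by_contra! hc
      have h1 := Finset.card_le_univ (G ∪ S)
      rw [Finset.card_union_of_disjoint (Finset.disjoint_left.2 hc), hG, hS] at h1
      omega
    exact Ideal.mem_of_dvd _ (Finset.dvd_prod_of_mem _ hi)
      (linearForm_mem_formsIdeal z (by simpa using hiS))
  · have := ha _ ⟨S, hS, rfl⟩
    rwa [Finset.sum_disjSum] at this

end Star

theorem exists_fin_span_range_eq {K V : Type*} [Field K] [AddCommGroup V] [Module K V]
    [FiniteDimensional K V] (W : Submodule K V) {n : ℕ} (h : Module.finrank K W = n) :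
    ∃ b : Fin n → V, Submodule.span K (Set.range b) = W := by
  refine ⟨fun i => Module.finBasisOfFinrankEq K W h i, ?_⟩
  have h1 := congrArg (Submodule.map W.subtype) (Module.finBasisOfFinrankEq K W h).span_eq
  rw [Submodule.map_span, ← Set.range_comp, Submodule.map_subtype_top] at h1
  exact h1

section Projective

variable {K : Type*} [Field K] {N d : ℕ}

theorem mem_hyperplane_mk (L : Module.Dual K (Fin (N + 1) → K)) (u : Fin (N + 1) → K)
    (hu : u ≠ 0) : Projectivization.mk K u hu ∈ hyperplane L ↔ L u = 0 := by
  rw [hyperplane, Set.mem_ofPred_eq, Projectivization.submodule_mk,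
    Submodule.span_singleton_le_iff_mem, LinearMap.mem_ker]

theorem pointIdeal_mk {κ : Type*} {z : κ → Module.Dual K (Fin (d + 1) → K)} {B : Finset κ}
    {v : Fin (d + 1) → K} (h : CutsOutPoint z B v) :
    pointIdeal (Projectivization.mk K v h.ne_zero) = formsIdeal z B := by
  rw [pointIdeal, Projectivization.submodule_mk, h.span_homogeneous_eq]

variable {φ : (Fin (N + 1) → K) →ₗ[K] (Fin (d + 1) → K)} {Y : Type*} [Fintype Y] {s : ℕ}
  {L : Fin s → Module.Dual K (Fin (N + 1) → K)}
  {z : Fin s ⊕ Y → Module.Dual K (Fin (d + 1) → K)}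

/-- Let `z` extend the equations `L` of the hyperplanes of a linear subspace, together with
`d - N` equations of this subspace. If the hyperplanes of `S` meet in the single point `[u]`, then
the corresponding forms cut out `[φ u]` in the big space. -/
theorem cutsOutPoint_of_unique (hNd : N < d) (hφ : Function.Injective φ)
    (hzL : ∀ i u, z (Sum.inl i) (φ u) = L i u)
    (hzφ : ∀ v, (∀ j, z (Sum.inr j) v = 0) ↔ ∃ u, φ u = v)
    (hY : Fintype.card Y = d - N) {S : Finset (Fin s)} (hS : S.card = N)
    {u : Fin (N + 1) → K} (hu : u ≠ 0) (hLu : ∀ i ∈ S, L i u = 0)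
    (huniq : ∀ u', u' ≠ 0 → (∀ i ∈ S, L i u' = 0) → u' ∈ Submodule.span K {u}) :
    CutsOutPoint z (S.disjSum Finset.univ) (φ u) := by
  have hne : φ u ≠ 0 := fun h => hu (hφ (h.trans (map_zero φ).symm))
  have hmem : ∀ M : Module.Dual K (Fin (d + 1) → K),
      M ∈ Submodule.span K (z '' (S.disjSum Finset.univ : Finset (Fin s ⊕ Y))) ↔ M (φ u) = 0 := by
    intro M
    constructor
    · intro hM
      have hle : Submodule.span K (z '' (S.disjSum Finset.univ : Finset (Fin s ⊕ Y))) ≤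
          LinearMap.ker (Module.Dual.eval K (Fin (d + 1) → K) (φ u)) := by
        rw [Submodule.span_le]
        rintro _ ⟨i, hi, rfl⟩
        rw [SetLike.mem_coe, LinearMap.mem_ker, Module.Dual.eval_apply]
        obtain i | i := i
        · rw [hzL]
          exact hLu i (by simpa using hi)
        · exact (hzφ _).2 ⟨u, rfl⟩ i
      exact hle hM
    · intro hM
      rw [Set.image_eq_range]
      refine mem_span_of_iInf_ker_le_ker fun w hw => ?_
      rw [Submodule.mem_iInf] at hw
      obtain ⟨u', rfl⟩ := (hzφ w).1 fun j => hw ⟨Sum.inr j, by simp⟩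
      have hu' : u' ∈ Submodule.span K {u} := by
        by_cases h0 : u' = 0
        · rw [h0]
          exact zero_mem _
        · refine huniq u' h0 fun i hi => ?_
          rw [← hzL]
          exact hw ⟨Sum.inl i, by simpa using hi⟩
      obtain ⟨c, rfl⟩ := Submodule.mem_span_singleton.1 hu'
      rw [LinearMap.mem_ker, map_smul, map_smul, hM, smul_zero]
  refine ⟨?_, hmem, hne⟩
  -- There are `d` functionals, and they span a space of dimension `d`.
  have hev : Module.Dual.eval K (Fin (d + 1) → K) (φ u) ≠ 0 := by
    intro h0
    obtain ⟨M, hM⟩ := exists_dual_apply_eq_one (K := K) hne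
    have := LinearMap.congr_fun h0 M
    rw [Module.Dual.eval_apply, hM] at this
    exact one_ne_zero this
  have hspan : Submodule.span K (z '' (S.disjSum Finset.univ : Finset (Fin s ⊕ Y))) =
      LinearMap.ker (Module.Dual.eval K (Fin (d + 1) → K) (φ u)) := by
    ext M
    rw [hmem, LinearMap.mem_ker, Module.Dual.eval_apply]
  have hrank := Module.Dual.finrank_ker_add_one_of_ne_zero hev
  rw [← hspan, Subspace.dual_finrank_eq, Module.finrank_fin_fun] at hrank
  rw [LinearIndepOn, linearIndependent_iff_card_eq_finrank_span, Set.finrank,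
    ← Set.image_eq_range]
  simp only [Finset.coe_sort_coe, Fintype.card_coe]
  rw [Finset.card_disjSum, hS, Finset.card_univ, hY]
  omega

end Projective

theorem mainTheorem2 {K : Type*} [Field K] [IsAlgClosed K] [CharZero K] {N d : ℕ} (hNd : N < d)
    (Z : Set (ProjSpace K N)) (hZ : IsStarConfiguration Z)
    (φ : (Fin (N + 1) → K) →ₗ[K] (Fin (d + 1) → K)) (hφ : Function.Injective φ)
    (I : Ideal (MvPolynomial (Fin (d + 1)) K))
    (hI : I = pointsIdeal (Projectivization.map φ hφ '' Z))
    (M : Ideal (MvPolynomial (Fin (d + 1)) K))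
    (hM : M = Ideal.span (Set.range MvPolynomial.X))
    (r : ℕ) (hr : 1 ≤ r) :
    symbolicPower I (r * d) ≤ M ^ (r * (d - 1)) * I ^ r ∧
      symbolicPower I (r * d - (d - 1)) ≤ M ^ ((r - 1) * (d - 1)) * I ^ r := by
  classical
  obtain ⟨s, L, hNs, -, huniq, hempty, rfl⟩ := hZ
  subst hM
  -- The linear equations in the big space: extensions of the `L i`, and equations of the subspace.
  obtain ⟨ψ, hψ⟩ := LinearMap.exists_leftInverse_of_injective φ (LinearMap.ker_eq_bot.2 hφ)
  have hfin : Module.finrank K (LinearMap.range φ).dualAnnihilator = d - N := by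
    have h1 := Subspace.finrank_add_finrank_dualAnnihilator_eq (LinearMap.range φ)
    rw [LinearMap.finrank_range_of_inj hφ, Module.finrank_fin_fun, Module.finrank_fin_fun] at h1
    omega
  obtain ⟨b, hb⟩ := exists_fin_span_range_eq (LinearMap.range φ).dualAnnihilator hfin
  set z : Fin s ⊕ Fin (d - N) → Module.Dual K (Fin (d + 1) → K) :=
    Sum.elim (fun i => L i ∘ₗ ψ) b with hz
  have hzL : ∀ i u, z (Sum.inl i) (φ u) = L i u := fun i u => by
    simpa [hz] using congrArg (L i) (LinearMap.congr_fun hψ u)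
  have hzφ : ∀ v, (∀ j, z (Sum.inr j) v = 0) ↔ ∃ u, φ u = v := by
    intro v
    rw [← LinearMap.mem_range,
      ← Subspace.dualAnnihilator_dualCoannihilator_eq (W := LinearMap.range φ),
      Submodule.mem_dualCoannihilator]
    constructor
    · intro h g hg
      rw [← hb] at hg
      have hle : Submodule.span K (Set.range b) ≤
          LinearMap.ker (Module.Dual.eval K (Fin (d + 1) → K) v) := by
        rw [Submodule.span_le]
        rintro _ ⟨j, rfl⟩
        exact h j
      exact hle hg
    · intro h j
      refine h _ ?_
      rw [← hb]
      exact Submodule.subset_span ⟨j, rfl⟩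
  have hpoint : ∀ S : Finset (Fin s), S.card = N → ∃ (u : Fin (N + 1) → K) (hu : u ≠ 0),
      (∀ P : ProjSpace K N, (∀ i ∈ S, P ∈ hyperplane (L i)) ↔ P = Projectivization.mk K u hu) ∧
      CutsOutPoint z (S.disjSum Finset.univ) (φ u) ∧
      ∀ i ∉ S.disjSum (Finset.univ : Finset (Fin (d - N))), z i (φ u) ≠ 0 := by
    intro S hS
    obtain ⟨P, hP, hPuniq⟩ := huniq S hS
    induction P using Projectivization.ind with
    | h u hu =>
    have hLu : ∀ i ∈ S, L i u = 0 := fun i hi => (mem_hyperplane_mk _ _ _).1 (hP i hi)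
    refine ⟨u, hu, fun P => ⟨hPuniq P, fun h => h ▸ hP⟩,
      cutsOutPoint_of_unique hNd hφ hzL hzφ (by simp) hS hu hLu fun u' hu' h => ?_, ?_⟩
    · have h1 := hPuniq (Projectivization.mk K u' hu') fun i hi =>
        (mem_hyperplane_mk _ _ _).2 (h i hi)
      rw [← Projectivization.submodule_mk u hu, ← h1, Projectivization.submodule_mk]
      exact Submodule.mem_span_singleton_self u'
    · rintro (i | j) hi
      · intro h0
        rw [hzL] at h0
        have hiS : i ∉ S := by simpa using hi
        refine hempty (insert i S) (by rw [Finset.card_insert_of_notMem hiS, hS])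
          ⟨Projectivization.mk K u hu, fun j hj => (mem_hyperplane_mk _ _ _).2 ?_⟩
        rcases Finset.mem_insert.1 hj with rfl | hj
        · exact h0
        · exact hLu j hj
      · simp at hi
  have hℬ : ∀ B ∈ starBases (Fin s) (Fin (d - N)) N,
      ∃ v, CutsOutPoint z B v ∧ ∀ i ∉ B, z i v ≠ 0 := by
    rintro _ ⟨S, hS, rfl⟩
    obtain ⟨u, -, -, h⟩ := hpoint S hS
    exact ⟨φ u, h⟩
  have hmem : ∀ f, f ∈ I ↔ ∀ B ∈ starBases (Fin s) (Fin (d - N)) N, f ∈ formsIdeal z B := by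
    intro f
    rw [hI, pointsIdeal]
    simp only [Submodule.mem_iInf]
    constructor
    · rintro h _ ⟨S, hS, rfl⟩
      obtain ⟨u, hu, hP, hcut, -⟩ := hpoint S hS
      rw [← pointIdeal_mk hcut]
      refine h _ ⟨Projectivization.mk K u hu, ⟨S, hS, (hP _).2 rfl⟩, ?_⟩
      rw [Projectivization.map_mk]
    · rintro h _ ⟨P, ⟨S, hS, hPS⟩, rfl⟩
      obtain ⟨u, hu, hP, hcut, -⟩ := hpoint S hS
      rw [(hP P).1 hPS, Projectivization.map_mk, pointIdeal_mk hcut]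
      exact h _ ⟨S, hS, rfl⟩
  have key := fun m hm => symbolicPower_le_of_starBases (m := m) hNd (by simpa using hNs) hr hm
    hℬ hmem
  obtain ⟨r, rfl⟩ : ∃ r', r = r' + 1 := ⟨r - 1, by omega⟩
  obtain ⟨d, rfl⟩ : ∃ d', d = d' + 1 := ⟨d - 1, by omega⟩
  constructor
  · convert key ((r + 1) * (d + 1)) ?_ using 3
    · simp only [Nat.add_sub_cancel]
      rw [Nat.mul_succ, Nat.add_sub_cancel]
    · simp only [Nat.add_sub_cancel]
      nlinarith
  · have hexp : (r + 1) * (d + 1) - (d + 1 - 1) = r * (d + 1) + 1 := by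
      rw [Nat.add_mul]
      omega
    rw [hexp]
    convert key (r * (d + 1) + 1) ?_ using 3
    · simp only [Nat.add_sub_cancel]
      rw [Nat.mul_succ]
      omega
    · simp
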